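/- A \emph{planar diagram} of a finite lattice $L$ represents the elements of $L$ by distinct points of the plane, larger elements being placed higher, and each covering $a\prec b$ by the straight line segment from $a$ to $b$, in such a way that no element lies in the interior of a segment and two different segments meet at most in a common endpoint. A \emph{left} (\emph{right}) \emph{corner} is a doubly irreducible element of $L\setminus\{0,1\}$ on the left (right) boundary of the diagram, that is, such that no point of the diagram at the same height is further to the left (right). A \emph{rectangular lattice} is a finite semimodular lattice that has a planar diagram with exactly one left corner $u_l$ and exactly one right corner $u_r$, and with $u_l\vee u_r=1$ and $u_l\wedge u_r=0$. Theorem. Let $D$ be a finite distributive lattice with at least two elements. Then there is a rectangular lattice $K$ such that $D$ is isomorphic to the congruence lattice $\operatorname{Con} K$ of $K$. -/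

import Mathlib

/-! ### The congruence lattice of a lattice -/

namespace LatticeCon

variable {L : Type*} [Lattice L]

theorem toSetoid_injective :
    Function.Injective (LatticeCon.toSetoid : LatticeCon L → Setoid L) := by
  intro c d h
  cases c
  cases d
  cases h
  rfl

/-- Congruences are ordered by inclusion: `c ≤ d` iff `c` relates `x` and `y` only if `d` does. -/
instance : PartialOrder (LatticeCon L) :=
  PartialOrder.lift LatticeCon.toSetoid toSetoid_injective

/-- The meet of a set of congruences is their intersection. -/
instance : InfSet (LatticeCon L) where
  sInf S :=
    { r := fun x y => ∀ c ∈ S, c.r x y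
      iseqv :=
        { refl := fun x c _ => c.refl x
          symm := fun h c hc => c.symm (h c hc)
          trans := fun h k c hc => c.trans (h c hc) (k c hc) }
      inf := fun h k c hc => c.inf (h c hc) (k c hc)
      sup := fun h k c hc => c.sup (h c hc) (k c hc) }

/-- The congruence lattice `Con L`. -/
instance : CompleteLattice (LatticeCon L) :=
  completeLatticeOfInf (LatticeCon L) fun _ =>
    ⟨fun c hc _ _ h => h c hc, fun _ hb _ _ h _ hc => hb hc h⟩

end LatticeCon

/-! ### Planar diagrams -/

/-- A planar diagram of a lattice: the elements are distinct points of the plane, larger elements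
are placed higher, each covering `a ⋖ b` is drawn as the straight line segment from `a` to `b`, no
element lies in the interior of a segment, and two different segments can only meet in the point
of a common endpoint. -/
structure PlanarDiagram (L : Type*) [Lattice L] where
  /-- the point of the plane that represents an element -/
  pos : L → ℝ × ℝ
  pos_injective : Function.Injective pos
  height_strictMono : StrictMono fun a => (pos a).2
  eq_of_mem_edge : ∀ {a b c : L}, a ⋖ b → pos c ∈ segment ℝ (pos a) (pos b) → c = a ∨ c = b
  edges_meet : ∀ {a b c d : L}, a ⋖ b → c ⋖ d → (a, b) ≠ (c, d) →
    ∀ p ∈ segment ℝ (pos a) (pos b) ∩ segment ℝ (pos c) (pos d),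
      ∃ x, (x = a ∨ x = b) ∧ (x = c ∨ x = d) ∧ p = pos x

namespace PlanarDiagram

variable {L : Type*} [Lattice L] (d : PlanarDiagram L)

/-- The subset of the plane that is drawn: all points of elements and all edges. -/
def support : Set (ℝ × ℝ) :=
  Set.range d.pos ∪ {p | ∃ a b : L, a ⋖ b ∧ p ∈ segment ℝ (d.pos a) (d.pos b)}

/-- The elements on the left boundary: no drawn point of the same height is further to the left. -/
def leftBoundary : Set L :=
  {x | ∀ p ∈ d.support, p.2 = (d.pos x).2 → (d.pos x).1 ≤ p.1}

/-- The elements on the right boundary: no drawn point of the same height is further to the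
right. -/
def rightBoundary : Set L :=
  {x | ∀ p ∈ d.support, p.2 = (d.pos x).2 → p.1 ≤ (d.pos x).1}

/-- A left corner: a doubly irreducible element, other than `0` and `1`, on the left boundary.
(`SupIrred` excludes `0` and `InfIrred` excludes `1`.) -/
def IsLeftCorner (x : L) : Prop :=
  SupIrred x ∧ InfIrred x ∧ x ∈ d.leftBoundary

/-- A right corner: a doubly irreducible element, other than `0` and `1`, on the right boundary. -/
def IsRightCorner (x : L) : Prop :=
  SupIrred x ∧ InfIrred x ∧ x ∈ d.rightBoundary

end PlanarDiagram

/-- A rectangular lattice: a finite (upper) semimodular lattice with a planar diagram in which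
there is exactly one left corner `ul` and exactly one right corner `ur`, and these two are
complements. -/
def IsRectangularLattice (L : Type*) [Lattice L] [BoundedOrder L] : Prop :=
  Finite L ∧ IsUpperModularLattice L ∧
    ∃ (d : PlanarDiagram L) (ul ur : L),
      (∀ x, d.IsLeftCorner x ↔ x = ul) ∧ (∀ x, d.IsRightCorner x ↔ x = ur) ∧ IsCompl ul ur

/-!
By Birkhoff's theorem `D` is the lattice of lower sets of a finite ordered set `P`, so it suffices
to realize the lower sets of `P` as congruences. Start with a square grid and call the strip between
the coordinates `k` and `k + 1`, in either direction, the `k`-th line of the grid. A congruence of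
the grid is given by the lines that it collapses, and these can be chosen freely for the two
directions. The lines are coloured by `P`, and two local modifications tie them together.

* An eye, a third atom inserted in a cell, turns the cell into a copy of `M₃`. Hence the two lines
  through the cell are collapsed simultaneously. The eyes are placed so that lines of the same
  colour are always collapsed together.
* A fork at the diagonal point `(k + 1, k + 1)` has the effect that collapsing the line `k` forces
  the line `k + 1` to be collapsed, but not conversely. The points of the grid that lie in one of
  the two directions above `(k + 1, k + 1)` are omitted for this. Each comparable pair of colours
  appears on the two lines of some fork.

The congruences then correspond to the sets of colours that are closed downwards.

The grid is drawn as a square that stands on a corner. A grid point below the two upper sides of the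
square has two upper covers, unless it is the diagonal point of a fork, which is a proper join; the
points of the upper sides are proper joins as well, except for the left and the right vertex of the
square. As the eyes are not on the boundary, these two vertices are the only corners.
-/

/-! ### Congruences and irreducible elements -/

section Lattice

variable {L : Type*} [Lattice L] {a b c d o t : L}

theorem latticeCon_r_of_le_of_le (θ : LatticeCon L) (h : θ.r a d) (hab : a ≤ b) (hbc : b ≤ c)
    (hcd : c ≤ d) : θ.r b c := by
  have := θ.inf (θ.sup h (θ.refl b)) (θ.refl c)
  rwa [sup_eq_right.2 hab, sup_eq_left.2 (hbc.trans hcd), inf_eq_left.2 hbc,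
    inf_eq_right.2 hcd] at this

theorem latticeCon_r_iff_of_monotone (θ : LatticeCon L) {f : ℕ → L} (hf : Monotone f) {i j : ℕ} :
    θ.r (f i) (f j) ↔ ∀ k, ¬θ.r (f k) (f (k + 1)) → (i ≤ k ↔ j ≤ k) := by
  wlog hij : i ≤ j generalizing i j
  · have hji := this (le_of_not_ge hij)
    exact ⟨fun h k hk => (hji.1 (θ.symm h) k hk).symm,
      fun h => θ.symm (hji.2 fun k hk => (h k hk).symm)⟩
  refine ⟨fun h k hk => ⟨fun hik => ?_, hij.trans⟩, fun h => ?_⟩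
  · by_contra! hkj
    exact hk (latticeCon_r_of_le_of_le θ h (hf hik) (hf k.le_succ) (hf hkj))
  · induction j, hij using Nat.le_induction with
    | base => exact θ.refl _
    | succ j hij ih =>
      have hj : θ.r (f j) (f (j + 1)) := by
        by_contra hj
        exact j.lt_irrefl ((h j hj).1 hij)
      exact θ.trans (ih fun k hk => by grind) hj

/-- The elements `o`, `a`, `b`, `c`, `t` form a copy of the modular lattice `M₃` with bottom `o`,
top `t` and atoms `a`, `b`, `c`. -/
structure IsDiamond (o a b c t : L) : Prop where
  inf₁₂ : a ⊓ b = o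
  inf₂₃ : b ⊓ c = o
  inf₃₁ : c ⊓ a = o
  sup₁₂ : a ⊔ b = t
  sup₂₃ : b ⊔ c = t
  sup₃₁ : c ⊔ a = t

namespace IsDiamond

variable (θ : LatticeCon L)

theorem rotate (h : IsDiamond o a b c t) : IsDiamond o b c a t :=
  ⟨h.inf₂₃, h.inf₃₁, h.inf₁₂, h.sup₂₃, h.sup₃₁, h.sup₁₂⟩

theorem r_bot_third (h : IsDiamond o a b c t) (ha : θ.r o a) : θ.r o c := by
  have hb := θ.inf (θ.sup ha (θ.refl b)) (θ.refl c)
  rwa [← h.inf₁₂, sup_eq_right.2 inf_le_right, h.sup₁₂, h.inf₂₃, ← h.sup₂₃,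
    inf_eq_right.2 le_sup_right] at hb

theorem r_bot_top_of_r_bot (h : IsDiamond o a b c t) (ha : θ.r o a) : θ.r o t := by
  have := θ.sup ha (h.rotate.rotate.r_bot_third θ (h.r_bot_third θ ha))
  rwa [sup_idem, h.sup₁₂] at this

theorem r_bot_of_r_bot_top (h : IsDiamond o a b c t) (ho : θ.r o t) : θ.r o a :=
  latticeCon_r_of_le_of_le θ ho le_rfl (h.inf₁₂ ▸ inf_le_left) (h.sup₁₂ ▸ le_sup_left)

theorem r_bot_iff (h : IsDiamond o a b c t) : θ.r o a ↔ θ.r o t :=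
  ⟨h.r_bot_top_of_r_bot θ, h.r_bot_of_r_bot_top θ⟩

theorem r_bot_top_of_r_top (h : IsDiamond o a b c t) (ha : θ.r a t) : θ.r o t := by
  have hb := θ.inf ha (θ.refl b)
  rw [h.inf₁₂, ← h.sup₁₂, inf_eq_right.2 le_sup_right] at hb
  exact h.rotate.r_bot_top_of_r_bot θ hb

end IsDiamond

theorem supIrred_of_isChain_Iic (ha : ¬IsMin a) (h : IsChain (· ≤ ·) (Set.Iic a)) :
    SupIrred a := by
  refine ⟨ha, ?_⟩
  rintro b c rfl
  rcases h.total (Set.mem_Iic.2 le_sup_left) (Set.mem_Iic.2 le_sup_right) with hbc | hcb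
  · exact Or.inr (sup_eq_right.2 hbc).symm
  · exact Or.inl (sup_eq_left.2 hcb).symm

theorem infIrred_of_isChain_Ici (ha : ¬IsMax a) (h : IsChain (· ≤ ·) (Set.Ici a)) :
    InfIrred a :=
  supIrred_toDual.1 (supIrred_of_isChain_Iic (by simpa using ha) h.symm)

theorem eq_of_infIrred_of_covBy (ha : InfIrred a) (hb : a ⋖ b) (hc : a ⋖ c) : b = c := by
  by_contra hbc
  rcases ha.2 (hb.wcovBy.inf_eq hc.wcovBy hbc) with rfl | rfl
  exacts [hb.lt.false, hc.lt.false]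

theorem supIrred_apply_iff {M : Type*} [Lattice M] (σ : L ≃o M) : SupIrred (σ a) ↔ SupIrred a := by
  simp only [SupIrred, σ.isMin_apply, σ.surjective.forall, ← map_sup, σ.injective.eq_iff]

theorem infIrred_apply_iff {M : Type*} [Lattice M] (σ : L ≃o M) : InfIrred (σ a) ↔ InfIrred a := by
  simp only [InfIrred, σ.isMax_apply, σ.surjective.forall, ← map_inf, σ.injective.eq_iff]

end Lattice

/-! ### Planar diagrams from order embeddings into the plane -/

section Segment

variable {𝕜 E L : Type*} [Field 𝕜] [LinearOrder 𝕜] [IsStrictOrderedRing 𝕜]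
  [AddCommGroup E] [PartialOrder E] [IsOrderedAddMonoid E] [Module 𝕜 E] [SMulPosMono 𝕜 E]

theorem eq_bot_of_mem_segment_of_covBy [PartialOrder L] (φ : L ↪o E) {a b c : L} (hb : a ⋖ b)
    (hc : a ⋖ c) (hbc : b ≠ c) {q : E} (hqb : q ∈ segment 𝕜 (φ a) (φ b))
    (hqc : q ∈ segment 𝕜 (φ a) (φ c)) : q = φ a := by
  rw [segment_eq_image'] at hqb hqc
  obtain ⟨s, ⟨hs, -⟩, rfl⟩ := hqb
  obtain ⟨r, ⟨hr, -⟩, hsr⟩ := hqc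
  wlog h : s ≤ r generalizing b c s r
  · exact hsr.symm.trans (this hc hb hbc.symm r hr s hsr.symm hs (le_of_not_ge h))
  rcases hr.eq_or_lt with rfl | hr
  · simpa using hsr.symm
  have hcb : φ c - φ a = (s / r) • (φ b - φ a) := by
    rw [div_eq_inv_mul, mul_smul, ← add_left_cancel hsr, inv_smul_smul₀ hr.ne']
  have hle : φ c - φ a ≤ φ b - φ a := by
    rw [hcb]
    exact smul_le_of_le_one_left (sub_nonneg.2 (φ.monotone hb.le)) ((div_le_one hr).2 h)
  rcases hb.eq_or_eq hc.le (φ.le_iff_le.1 (sub_le_sub_iff_right _ |>.1 hle)) with rfl | rfl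
  exacts [absurd hc.lt (lt_irrefl _), absurd rfl hbc]

theorem eq_top_of_mem_segment_of_covBy [PartialOrder L] (φ : L ↪o E) {a b c : L} (ha : a ⋖ c)
    (hb : b ⋖ c) (hab : a ≠ b) {q : E} (hqa : q ∈ segment 𝕜 (φ a) (φ c))
    (hqb : q ∈ segment 𝕜 (φ b) (φ c)) : q = φ c := by
  rw [segment_symm] at hqa hqb
  exact eq_bot_of_mem_segment_of_covBy (E := Eᵒᵈ) φ.dual ha.toDual hb.toDual hab hqa hqb

theorem exists_common_endpoint_of_mem_segment [PosSMulMono 𝕜 E] [Lattice L] (φ : L ↪o E)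
    {a b c d : L} (hab : a ⋖ b) (hcd : c ⋖ d) (hne : (a, b) ≠ (c, d)) {q : E}
    (hq₁ : q ∈ segment 𝕜 (φ a) (φ b)) (hq₂ : q ∈ segment 𝕜 (φ c) (φ d)) :
    ∃ x, (x = a ∨ x = b) ∧ (x = c ∨ x = d) ∧ q = φ x := by
  obtain ⟨haq, hqb⟩ := segment_subset_Icc (φ.monotone hab.le) hq₁
  obtain ⟨hcq, hqd⟩ := segment_subset_Icc (φ.monotone hcd.le) hq₂
  have had : a ≤ d := φ.le_iff_le.1 (haq.trans hqd)
  have hcb : c ≤ b := φ.le_iff_le.1 (hcq.trans hqb)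
  rcases hab.eq_or_eq (c := a ⊔ c) le_sup_left (sup_le hab.le hcb) with h₁ | h₁ <;>
    rcases hcd.eq_or_eq (c := a ⊔ c) le_sup_right (sup_le had hcd.le) with h₂ | h₂ <;>
    obtain rfl := h₁.symm.trans h₂
  · exact ⟨a, .inl rfl, .inl rfl,
      eq_bot_of_mem_segment_of_covBy φ hab hcd (by simpa using hne) hq₁ hq₂⟩
  · exact ⟨a, .inl rfl, .inr rfl, hqd.antisymm haq⟩
  · exact ⟨b, .inr rfl, .inl rfl, hqb.antisymm hcq⟩
  · exact ⟨b, .inr rfl, .inr rfl,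
      eq_top_of_mem_segment_of_covBy φ hab hcd (by simpa using hne) hq₁ hq₂⟩

end Segment

/-- The similarity of the plane that turns the product order towards the vertical: a point that is
larger in both coordinates is sent to a higher point. -/
def planeTurn : ℝ × ℝ →ₗ[ℝ] ℝ × ℝ :=
  (LinearMap.snd ℝ ℝ ℝ - LinearMap.fst ℝ ℝ ℝ).prod (LinearMap.fst ℝ ℝ ℝ + LinearMap.snd ℝ ℝ ℝ)

theorem planeTurn_apply (q : ℝ × ℝ) : planeTurn q = (q.2 - q.1, q.1 + q.2) := rfl

theorem planeTurn_injective : Function.Injective planeTurn := by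
  intro p q h
  simp only [planeTurn_apply, Prod.mk.injEq] at h
  ext <;> linarith [h.1, h.2]

theorem planeTurn_snd_strictMono : StrictMono fun q => (planeTurn q).2 := by
  intro p q h
  rcases Prod.lt_iff.1 h with ⟨h₁, h₂⟩ | ⟨h₁, h₂⟩ <;> exact by
    simp only [planeTurn_apply]; linarith

theorem mem_segment_planeTurn {u v p : ℝ × ℝ} :
    p ∈ segment ℝ (planeTurn u) (planeTurn v) ↔ ∃ q ∈ segment ℝ u v, planeTurn q = p := by
  rw [← LinearMap.coe_toAffineMap, ← image_segment]
  rfl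

theorem planeTurn_mem_segment {u v q : ℝ × ℝ} :
    planeTurn q ∈ segment ℝ (planeTurn u) (planeTurn v) ↔ q ∈ segment ℝ u v := by
  simp [mem_segment_planeTurn, planeTurn_injective.eq_iff]

namespace PlanarDiagram

variable {L : Type*} [Lattice L]

/-- The diagram of a lattice that embeds, as an ordered set, into the plane with the product
order. -/
def ofOrderEmbedding (φ : L ↪o ℝ × ℝ) : PlanarDiagram L where
  pos x := planeTurn (φ x)
  pos_injective := planeTurn_injective.comp φ.injective
  height_strictMono := planeTurn_snd_strictMono.comp φ.strictMono
  eq_of_mem_edge hab hc :=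
    have ⟨hac, hcb⟩ := segment_subset_Icc (φ.monotone hab.le) (planeTurn_mem_segment.1 hc)
    hab.eq_or_eq (φ.le_iff_le.1 hac) (φ.le_iff_le.1 hcb)
  edges_meet := by
    rintro a b c d hab hcd hne p ⟨hp₁, hp₂⟩
    obtain ⟨q, hq, rfl⟩ := mem_segment_planeTurn.1 hp₁
    obtain ⟨x, hxab, hxcd, rfl⟩ := exists_common_endpoint_of_mem_segment φ hab hcd hne hq
      (planeTurn_mem_segment.1 hp₂)
    exact ⟨x, hxab, hxcd, rfl⟩

variable {φ : L ↪o ℝ × ℝ} {x : L}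

theorem planeTurn_mem_support_of_covBy {a b : L} (h : a ⋖ b) {q : ℝ × ℝ}
    (hq : q ∈ segment ℝ (φ a) (φ b)) : planeTurn q ∈ (ofOrderEmbedding φ).support :=
  Or.inr ⟨a, b, h, planeTurn_mem_segment.2 hq⟩

theorem exists_of_mem_support {p l u : ℝ × ℝ} (h : ∀ x, φ x ∈ Set.Icc l u)
    (hp : p ∈ (ofOrderEmbedding φ).support) : ∃ q ∈ Set.Icc l u, planeTurn q = p := by
  rcases hp with ⟨x, rfl⟩ | ⟨a, b, -, hp⟩
  · exact ⟨φ x, h x, rfl⟩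
  · obtain ⟨q, hq, rfl⟩ := mem_segment_planeTurn.1 hp
    exact ⟨q, (convex_Icc l u).segment_subset (h a) (h b) hq, rfl⟩

theorem mem_leftBoundary_of_eq_corner {l u : ℝ × ℝ} (h : ∀ y, φ y ∈ Set.Icc l u)
    (hx : φ x = (u.1, l.2)) : x ∈ (ofOrderEmbedding φ).leftBoundary := by
  intro p hp _
  obtain ⟨q, ⟨⟨-, hl⟩, hu, -⟩, rfl⟩ := exists_of_mem_support h hp
  change (planeTurn (φ x)).1 ≤ _
  rw [hx]
  simp only [planeTurn_apply]
  linarith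

theorem isLeftCorner_of_eq_corner {l u : ℝ × ℝ} (h : ∀ y, φ y ∈ Set.Icc l u)
    (hx : φ x = (u.1, l.2)) (hmin : ¬IsMin x) (hmax : ¬IsMax x) :
    (ofOrderEmbedding φ).IsLeftCorner x := by
  refine ⟨supIrred_of_isChain_Iic hmin fun y hy z hz _ => ?_,
    infIrred_of_isChain_Ici hmax fun y hy z hz _ => ?_, mem_leftBoundary_of_eq_corner h hx⟩
  · have snd_eq {w : L} (hw : w ≤ x) : (φ w).2 = l.2 :=
      le_antisymm ((φ.monotone hw).2.trans_eq (by rw [hx])) (h w).1.2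
    have hyz : (φ y).2 = (φ z).2 := (snd_eq hy).trans (snd_eq hz).symm
    exact (le_total (φ y).1 (φ z).1).imp (fun h => φ.le_iff_le.1 ⟨h, hyz.le⟩)
      fun h => φ.le_iff_le.1 ⟨h, hyz.ge⟩
  · have fst_eq {w : L} (hw : x ≤ w) : (φ w).1 = u.1 :=
      le_antisymm (h w).2.1 (Eq.trans_le (by rw [hx]) (φ.monotone hw).1)
    have hyz : (φ y).1 = (φ z).1 := (fst_eq hy).trans (fst_eq hz).symm
    exact (le_total (φ y).2 (φ z).2).imp (fun h => φ.le_iff_le.1 ⟨hyz.le, h⟩)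
      fun h => φ.le_iff_le.1 ⟨hyz.ge, h⟩

theorem notMem_leftBoundary {q : ℝ × ℝ} (hq : planeTurn q ∈ (ofOrderEmbedding φ).support)
    (hsum : q.1 + q.2 = (φ x).1 + (φ x).2) (hlt : (φ x).1 < q.1) :
    x ∉ (ofOrderEmbedding φ).leftBoundary := by
  intro hx
  have := hx _ hq hsum
  change q.2 - q.1 ≥ (φ x).2 - (φ x).1 at this
  linarith

section Reflection

variable {σ : L ≃o L} (hσ : ∀ x, φ (σ x) = (φ x).swap)

include hσ

theorem reflect_mem_support {p : ℝ × ℝ} (hp : p ∈ (ofOrderEmbedding φ).support) :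
    (-p.1, p.2) ∈ (ofOrderEmbedding φ).support := by
  have key : ∀ q : ℝ × ℝ, (-(planeTurn q).1, (planeTurn q).2) = planeTurn q.swap := fun q => by
    simp [planeTurn_apply, add_comm]
  rcases hp with ⟨x, rfl⟩ | ⟨a, b, hab, hp⟩
  · exact Or.inl ⟨σ x, by simp only [ofOrderEmbedding, hσ, key]⟩
  · obtain ⟨q, ⟨s, r, hs, hr, hsr, rfl⟩, rfl⟩ := mem_segment_planeTurn.1 hp
    rw [key]
    exact planeTurn_mem_support_of_covBy ((apply_covBy_apply_iff σ).2 hab)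
      ⟨s, r, hs, hr, hsr, by simp [hσ]⟩

theorem mem_rightBoundary_iff_of_swap :
    x ∈ (ofOrderEmbedding φ).rightBoundary ↔ σ x ∈ (ofOrderEmbedding φ).leftBoundary := by
  have hx : (ofOrderEmbedding φ).pos (σ x) =
      (-((ofOrderEmbedding φ).pos x).1, ((ofOrderEmbedding φ).pos x).2) := by
    simp [ofOrderEmbedding, planeTurn_apply, hσ, add_comm]
  constructor <;> intro h p hp hpx <;> have := h _ (reflect_mem_support hσ hp) (by simp_all) <;>
    simp only [hx] at * <;> linarith

theorem isRightCorner_iff_of_swap :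
    (ofOrderEmbedding φ).IsRightCorner x ↔ (ofOrderEmbedding φ).IsLeftCorner (σ x) := by
  rw [IsRightCorner, IsLeftCorner, supIrred_apply_iff, infIrred_apply_iff,
    mem_rightBoundary_iff_of_swap hσ]

end Reflection

end PlanarDiagram

theorem isCompl_of_map_inf_of_map_sup {L E : Type*} [PartialOrder L] [BoundedOrder L] [Lattice E]
    (φ : L ↪o E) {a b : L} (hinf : φ a ⊓ φ b = φ ⊥) (hsup : φ a ⊔ φ b = φ ⊤) : IsCompl a b where
  disjoint _ ha hb := φ.le_iff_le.1 (hinf ▸ le_inf (φ.monotone ha) (φ.monotone hb))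
  codisjoint _ ha hb := φ.le_iff_le.1 (hsup ▸ sup_le (φ.monotone ha) (φ.monotone hb))

/-! ### Adding eyes to a lattice -/

/-- The places for eyes in a lattice `S`: the eye `e` is a new element, to be inserted strictly
between the elements `lo e < hi e` of `S` and comparable with nothing else. -/
structure EyeFamily (S E : Type*) [Lattice S] where
  lo : E → S
  hi : E → S
  lo_lt_hi : ∀ e, lo e < hi e

/-- The lattice that arises from `S` by inserting the eyes of the family `A`. -/
inductive WithEyes {S E : Type*} [Lattice S] (A : EyeFamily S E) : Type _
  | old : S → WithEyes A
  | eye : E → WithEyes A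

namespace WithEyes

variable {S E : Type*} [Lattice S] {A : EyeFamily S E}

/-- The largest old element below `u`, which is `u` itself if `u` is old. -/
def lo : (u : WithEyes A) → S
  | old s => s
  | eye e => A.lo e

/-- The smallest old element above `u`, which is `u` itself if `u` is old. -/
def hi : (u : WithEyes A) → S
  | old s => s
  | eye e => A.hi e

@[simp] theorem lo_old (s : S) : (old s : WithEyes A).lo = s := rfl
@[simp] theorem hi_old (s : S) : (old s : WithEyes A).hi = s := rfl
@[simp] theorem lo_eye (e : E) : (eye e : WithEyes A).lo = A.lo e := rfl
@[simp] theorem hi_eye (e : E) : (eye e : WithEyes A).hi = A.hi e := rfl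

theorem lo_le_hi (u : WithEyes A) : u.lo ≤ u.hi := by
  cases u with
  | old s => exact le_rfl
  | eye e => exact (A.lo_lt_hi e).le

theorem eq_old_of_hi_le_lo {u : WithEyes A} (h : u.hi ≤ u.lo) : u = old u.lo := by
  cases u with
  | old s => rfl
  | eye e => exact absurd h (A.lo_lt_hi e).not_ge

instance : PartialOrder (WithEyes A) where
  le u v := u = v ∨ u.hi ≤ v.lo
  le_refl u := Or.inl rfl
  le_trans := by
    rintro u v w (rfl | h₁) (rfl | h₂)
    · exact Or.inl rfl
    · exact Or.inr h₂
    · exact Or.inr h₁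
    · exact Or.inr (h₁.trans (v.lo_le_hi.trans h₂))
  le_antisymm := by
    rintro u v (rfl | h₁) (h | h₂)
    · rfl
    · rfl
    · exact h.symm
    · have hu := u.lo_le_hi
      have hv := v.lo_le_hi
      rw [eq_old_of_hi_le_lo (h₁.trans (hv.trans h₂)), eq_old_of_hi_le_lo (h₂.trans (hu.trans h₁)),
        (hu.trans h₁).antisymm (hv.trans h₂)]

theorem le_of_hi_le_lo {u v : WithEyes A} (h : u.hi ≤ v.lo) : u ≤ v := Or.inr h

@[simp] theorem old_le {s : S} {u : WithEyes A} : old s ≤ u ↔ s ≤ u.lo := by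
  refine ⟨?_, Or.inr⟩
  rintro (rfl | h)
  exacts [le_rfl, h]

@[simp] theorem le_old {s : S} {u : WithEyes A} : u ≤ old s ↔ u.hi ≤ s := by
  refine ⟨?_, Or.inr⟩
  rintro (rfl | h)
  exacts [le_rfl, h]

theorem lo_mono {u v : WithEyes A} (h : u ≤ v) : u.lo ≤ v.lo := by
  rcases h with rfl | h
  exacts [le_rfl, u.lo_le_hi.trans h]

theorem hi_mono {u v : WithEyes A} (h : u ≤ v) : u.hi ≤ v.hi := by
  rcases h with rfl | h
  exacts [le_rfl, h.trans v.lo_le_hi]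

@[simp] theorem old_lt_old {s t : S} : (old s : WithEyes A) < old t ↔ s < t := by
  simp [lt_iff_le_not_ge]

theorem eye_le_eye {e f : E} : (eye e : WithEyes A) ≤ eye f ↔ e = f ∨ A.hi e ≤ A.lo f :=
  or_congr_left (eye.injEq e f).to_iff

open Classical in
noncomputable instance : Lattice (WithEyes A) where
  inf u v := if u ≤ v then u else if v ≤ u then v else old (u.lo ⊓ v.lo)
  sup u v := if u ≤ v then v else if v ≤ u then u else old (u.hi ⊔ v.hi)
  inf_le_left u v := by
    split_ifs with h₁ h₂
    · exact le_rfl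
    · exact h₂
    · simp
  inf_le_right u v := by
    split_ifs with h₁ h₂
    · exact h₁
    · exact le_rfl
    · simp
  le_inf w u v hu hv := by
    split_ifs with h₁ h₂
    · exact hu
    · exact hv
    · rcases hu with rfl | hu
      · exact absurd hv h₁
      rcases hv with rfl | hv
      · exact absurd (le_of_hi_le_lo hu) h₂
      exact le_old.2 (le_inf hu hv)
  le_sup_left u v := by
    split_ifs with h₁ h₂
    · exact h₁
    · exact le_rfl
    · simp
  le_sup_right u v := by
    split_ifs with h₁ h₂
    · exact le_rfl
    · exact h₂
    · simp
  sup_le u v w hu hv := by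
    split_ifs with h₁ h₂
    · exact hv
    · exact hu
    · rcases hu with rfl | hu
      · exact absurd hv h₂
      rcases hv with rfl | hv
      · exact absurd (le_of_hi_le_lo hu) h₁
      exact old_le.2 (sup_le hu hv)

open Classical in
theorem inf_eq_of_not_le {u v : WithEyes A} (h₁ : ¬u ≤ v) (h₂ : ¬v ≤ u) :
    u ⊓ v = old (u.lo ⊓ v.lo) := by
  change (if u ≤ v then u else if v ≤ u then v else old (u.lo ⊓ v.lo)) = _
  rw [if_neg h₁, if_neg h₂]

open Classical in
theorem sup_eq_of_not_le {u v : WithEyes A} (h₁ : ¬u ≤ v) (h₂ : ¬v ≤ u) :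
    u ⊔ v = old (u.hi ⊔ v.hi) := by
  change (if u ≤ v then v else if v ≤ u then u else old (u.hi ⊔ v.hi)) = _
  rw [if_neg h₁, if_neg h₂]

@[simp] theorem old_inf_old (s t : S) : (old s ⊓ old t : WithEyes A) = old (s ⊓ t) :=
  le_antisymm (by
    rw [le_old]
    exact le_inf (le_old.1 inf_le_left) (le_old.1 inf_le_right)) (by simp)

@[simp] theorem old_sup_old (s t : S) : (old s ⊔ old t : WithEyes A) = old (s ⊔ t) :=
  le_antisymm (by simp) (by
    rw [old_le]
    exact sup_le (old_le.1 le_sup_left) (old_le.1 le_sup_right))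

theorem lo_inf (u v : WithEyes A) : (u ⊓ v).lo = u.lo ⊓ v.lo := by
  by_cases h₁ : u ≤ v
  · rw [inf_eq_left.2 h₁, inf_eq_left.2 (lo_mono h₁)]
  by_cases h₂ : v ≤ u
  · rw [inf_eq_right.2 h₂, inf_eq_right.2 (lo_mono h₂)]
  rw [inf_eq_of_not_le h₁ h₂, lo_old]

theorem hi_sup (u v : WithEyes A) : (u ⊔ v).hi = u.hi ⊔ v.hi := by
  by_cases h₁ : u ≤ v
  · rw [sup_eq_right.2 h₁, sup_eq_right.2 (hi_mono h₁)]
  by_cases h₂ : v ≤ u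
  · rw [sup_eq_left.2 h₂, sup_eq_left.2 (hi_mono h₂)]
  rw [sup_eq_of_not_le h₁ h₂, hi_old]

instance [BoundedOrder S] : BoundedOrder (WithEyes A) where
  top := old ⊤
  bot := old ⊥
  le_top := by simp
  bot_le := by simp

theorem top_def [BoundedOrder S] : (⊤ : WithEyes A) = old ⊤ := rfl
theorem bot_def [BoundedOrder S] : (⊥ : WithEyes A) = old ⊥ := rfl

instance [Finite S] [Finite E] : Finite (WithEyes A) := by
  refine Finite.of_surjective (Sum.elim old eye : S ⊕ E → WithEyes A) ?_
  rintro (s | e)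
  · exact ⟨Sum.inl s, rfl⟩
  · exact ⟨Sum.inr e, rfl⟩

theorem lo_covBy_eye (e : E) : old (A.lo e) ⋖ (eye e : WithEyes A) := by
  refine ⟨lt_of_le_not_ge (by simp) (by simpa using (A.lo_lt_hi e).not_ge), fun u h₁ h₂ => ?_⟩
  rcases h₂.le with rfl | h
  exacts [h₂.false, h₁.not_ge (le_old.2 h)]

theorem eye_covBy_hi (e : E) : (eye e : WithEyes A) ⋖ old (A.hi e) := by
  refine ⟨lt_of_le_not_ge (by simp) (by simpa using (A.lo_lt_hi e).not_ge), fun u h₁ h₂ => ?_⟩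
  rcases h₁.le with rfl | h
  exacts [h₁.false, h₂.not_ge (old_le.2 h)]

theorem eq_lo_of_covBy_eye {u : WithEyes A} {e : E} (h : u ⋖ eye e) : u = old (A.lo e) := by
  rcases h.le with rfl | h'
  · exact absurd h.lt (lt_irrefl _)
  · rcases h.eq_or_eq (c := old (A.lo e)) (le_old.2 h') (by simp) with h'' | h''
    · exact h''.symm
    · cases h''

theorem covBy_of_old_covBy_old {s t : S} (h : (old s : WithEyes A) ⋖ old t) : s ⋖ t :=
  ⟨old_lt_old.1 h.lt, fun _ h₁ h₂ => h.2 (old_lt_old.2 h₁) (old_lt_old.2 h₂)⟩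

theorem supIrred_of_old {s : S} (h : SupIrred (old s : WithEyes A)) : SupIrred s :=
  ⟨fun hs => h.1 fun u hu => old_le.2 (hs (u.lo_le_hi.trans (le_old.1 hu))), fun a b hab => by
    simpa using h.2 (show (old a ⊔ old b : WithEyes A) = old s by rw [old_sup_old, hab])⟩

theorem infIrred_of_old {s : S} (h : InfIrred (old s : WithEyes A)) : InfIrred s :=
  ⟨fun hs => h.1 fun u hu => le_old.2 (hs ((old_le.1 hu).trans u.lo_le_hi)), fun a b hab => by
    simpa using h.2 (show (old a ⊓ old b : WithEyes A) = old s by rw [old_inf_old, hab])⟩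

/-- The families of eyes whose intervals `[lo e, hi e]` have length two and contain all upper covers
of `lo e`; inserting such eyes preserves coverings and semimodularity. -/
def IsShort (A : EyeFamily S E) : Prop := ∀ e s, A.lo e ⋖ s → s ⋖ A.hi e

theorem IsShort.exists_between [Finite S] (hA : IsShort A) {e : E} {s : S} (h : A.lo e < s) :
    ∃ t, A.lo e ⋖ t ∧ t ≤ s ∧ t ⋖ A.hi e := by
  obtain ⟨t, ht, hts⟩ := exists_covBy_le_of_lt h
  exact ⟨t, ht, hts, hA e t ht⟩

theorem old_covBy_old [Finite S] (hA : IsShort A) {s t : S} (h : s ⋖ t) :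
    (old s : WithEyes A) ⋖ old t := by
  refine ⟨old_lt_old.2 h.lt, ?_⟩
  rintro (u | e) h₁ h₂
  · exact h.2 (old_lt_old.1 h₁) (old_lt_old.1 h₂)
  · have h₁' : s ≤ A.lo e := old_le.1 h₁.le
    have h₂' : A.hi e ≤ t := le_old.1 h₂.le
    obtain ⟨w, hw₁, -, hw₂⟩ := hA.exists_between (A.lo_lt_hi e)
    exact h.2 (h₁'.trans_lt hw₁.lt) (hw₂.lt.trans_le h₂')

theorem covBy_hi_sup [Finite S] [IsUpperModularLattice S] (hA : IsShort A) {e : E} {s : S}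
    (h : A.lo e < s) (h' : ¬A.hi e ≤ s) : s ⋖ A.hi e ⊔ s := by
  obtain ⟨t, -, hts, hth⟩ := hA.exists_between h
  refine IsUpperModularLattice.covBy_sup_of_inf_covBy ?_
  have : A.hi e ⊓ s = t := by
    rcases hth.eq_or_eq (c := A.hi e ⊓ s) (le_inf hth.le hts) inf_le_left with h | h
    · exact h
    · exact absurd (inf_eq_left.1 h) h'
  rwa [this]

theorem isUpperModularLattice [Finite S] [IsUpperModularLattice S] (hA : IsShort A)
    (hinj : A.lo.Injective) : IsUpperModularLattice (WithEyes A) where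
  covBy_sup_of_inf_covBy := by
    intro u v h
    have huv : ¬u ≤ v := fun h' => (inf_eq_left.2 h' ▸ h).lt.false
    by_cases hvu : v ≤ u
    · rwa [sup_eq_left.2 hvu, ← inf_eq_right.2 hvu]
    rw [inf_eq_of_not_le huv hvu] at h
    rw [sup_eq_of_not_le huv hvu]
    rcases u with s | e <;> rcases v with t | f
    · exact old_covBy_old hA
        (IsUpperModularLattice.covBy_sup_of_inf_covBy (covBy_of_old_covBy_old h))
    · simp only [lo_old, lo_eye, hi_old, hi_eye] at h ⊢
      have h₁ := hA f _ (IsUpperModularLattice.covBy_sup_of_inf_covBy (covBy_of_old_covBy_old h))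
      rw [sup_eq_right.2 (le_sup_left.trans h₁.le)]
      exact eye_covBy_hi f
    · simp only [lo_old, lo_eye, hi_old, hi_eye] at h ⊢
      have h₁ : A.lo e ⊓ t = A.lo e := by simpa using eq_lo_of_covBy_eye h
      have h₂ : A.lo e < t := (inf_eq_left.1 h₁).lt_of_ne (by rintro rfl; exact hvu (by simp))
      exact old_covBy_old hA (covBy_hi_sup hA h₂ (by simpa using huv))
    · simp only [lo_eye, hi_eye] at h ⊢
      have h₁ : A.lo e ⊓ A.lo f = A.lo e := by simpa using eq_lo_of_covBy_eye h
      have h₂ : A.lo e < A.lo f := (inf_eq_left.1 h₁).lt_of_ne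
        fun h => huv (by rw [hinj h])
      have h₃ := hA f _ (covBy_hi_sup hA h₂ fun h => huv (le_of_hi_le_lo h))
      rw [sup_eq_right.2 (le_sup_left.trans h₃.le)]
      exact eye_covBy_hi f

/-! ### Congruences of a lattice with eyes -/

/-- A congruence `θ` of `S` collapses the element `u` if it identifies the old elements next to `u`;
it always collapses the old elements. -/
def Collapses (θ : LatticeCon S) (u : WithEyes A) : Prop := θ.r u.lo u.hi

/-- The congruences of `S` that extend to the lattice with eyes: each eye that is not collapsed lies
between the top of one congruence class and the bottom of another. -/
def IsExtendable (A : EyeFamily S E) (θ : LatticeCon S) : Prop :=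
  ∀ e, θ.r (A.lo e) (A.hi e) ∨
    (∀ s, θ.r s (A.hi e) → A.hi e ≤ s) ∧ ∀ s, θ.r s (A.lo e) → s ≤ A.lo e

/-- The relation of the extended congruence: a collapsed eye is related to its neighbours, the other
eyes are alone in their class. -/
def ExtendRel (θ : LatticeCon S) (u v : WithEyes A) : Prop :=
  u = v ∨ Collapses θ u ∧ Collapses θ v ∧ θ.r u.lo v.lo

variable {θ : LatticeCon S} {u v w : WithEyes A}

theorem Collapses.inf (hu : Collapses θ u) (hw : w ≤ u → Collapses θ w) :
    Collapses θ (u ⊓ w) := by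
  by_cases h₁ : u ≤ w
  · rwa [inf_eq_left.2 h₁]
  by_cases h₂ : w ≤ u
  · rw [inf_eq_right.2 h₂]
    exact hw h₂
  · rw [inf_eq_of_not_le h₁ h₂]
    exact θ.refl _

theorem Collapses.sup (hu : Collapses θ u) (hw : u ≤ w → Collapses θ w) :
    Collapses θ (u ⊔ w) := by
  by_cases h₁ : u ≤ w
  · rw [sup_eq_right.2 h₁]
    exact hw h₁
  by_cases h₂ : w ≤ u
  · rwa [sup_eq_left.2 h₂]
  · rw [sup_eq_of_not_le h₁ h₂]
    exact θ.refl _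

theorem eye_le_of_r {e : E} (he : ¬Collapses θ (eye e : WithEyes A))
    (hmin : ∀ s, θ.r s (A.hi e) → A.hi e ≤ s) (hu : Collapses θ u) (h : θ.r u.lo v.lo)
    (hle : eye e ≤ u) : eye e ≤ v := by
  rcases hle with rfl | hle
  · exact absurd hu he
  have h' := θ.inf h (θ.refl (A.hi e))
  rw [inf_eq_right.2 (show A.hi e ≤ u.lo from hle)] at h'
  exact le_of_hi_le_lo ((hmin _ (θ.symm h')).trans inf_le_left)

theorem le_eye_of_r {e : E} (he : ¬Collapses θ (eye e : WithEyes A))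
    (hmax : ∀ s, θ.r s (A.lo e) → s ≤ A.lo e) (hu : Collapses θ u) (h : θ.r u.hi v.hi)
    (hle : u ≤ eye e) : v ≤ eye e := by
  rcases hle with rfl | hle
  · exact absurd hu he
  have h' := θ.sup h (θ.refl (A.lo e))
  rw [sup_eq_right.2 (show u.hi ≤ A.lo e from hle)] at h'
  exact le_of_hi_le_lo (le_sup_left.trans (hmax _ (θ.symm h')))

namespace ExtendRel

theorem symm : ExtendRel θ u v → ExtendRel θ v u := by
  rintro (rfl | ⟨hu, hv, h⟩)
  exacts [Or.inl rfl, Or.inr ⟨hv, hu, θ.symm h⟩]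

theorem trans : ExtendRel θ u v → ExtendRel θ v w → ExtendRel θ u w := by
  rintro (rfl | ⟨hu, hv, h⟩) (rfl | ⟨hv', hw, h'⟩)
  exacts [Or.inl rfl, Or.inr ⟨hv', hw, h'⟩, Or.inr ⟨hu, hv, h⟩, Or.inr ⟨hu, hw, θ.trans h h'⟩]

theorem mono {θ' : LatticeCon S} (hθ : θ ≤ θ') : ExtendRel θ u v → ExtendRel θ' u v :=
  Or.imp_right fun ⟨hu, hv, h⟩ => ⟨hθ hu, hθ hv, hθ h⟩

theorem of_r_hi (hu : Collapses θ u) (hv : Collapses θ v) (h : θ.r u.hi v.hi) :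
    ExtendRel θ u v :=
  Or.inr ⟨hu, hv, θ.trans hu (θ.trans h (θ.symm hv))⟩

theorem inf_right (hθ : IsExtendable A θ) (h : ExtendRel θ u v) (w : WithEyes A) :
    ExtendRel θ (u ⊓ w) (v ⊓ w) := by
  rcases h with rfl | ⟨hu, hv, h⟩
  · exact Or.inl rfl
  have hlo : θ.r (u ⊓ w).lo (v ⊓ w).lo := by
    rw [lo_inf, lo_inf]
    exact θ.inf h (θ.refl _)
  by_cases hw : Collapses θ w
  · exact Or.inr ⟨hu.inf fun _ => hw, hv.inf fun _ => hw, hlo⟩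
  rcases w with s | e
  · exact absurd (θ.refl s) hw
  obtain ⟨hmin, -⟩ := (hθ e).resolve_left hw
  have hiff : eye e ≤ u ↔ eye e ≤ v :=
    ⟨eye_le_of_r hw hmin hu h, eye_le_of_r hw hmin hv (θ.symm h)⟩
  by_cases he : eye e ≤ u
  · rw [inf_eq_right.2 he, inf_eq_right.2 (hiff.1 he)]
    exact Or.inl rfl
  · exact Or.inr ⟨hu.inf fun h => absurd h he, hv.inf fun h => absurd (hiff.2 h) he, hlo⟩

theorem sup_right (hθ : IsExtendable A θ) (h : ExtendRel θ u v) (w : WithEyes A) :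
    ExtendRel θ (u ⊔ w) (v ⊔ w) := by
  rcases h with rfl | ⟨hu, hv, h⟩
  · exact Or.inl rfl
  have h : θ.r u.hi v.hi := θ.trans (θ.symm hu) (θ.trans h hv)
  have hhi : θ.r (u ⊔ w).hi (v ⊔ w).hi := by
    rw [hi_sup, hi_sup]
    exact θ.sup h (θ.refl _)
  by_cases hw : Collapses θ w
  · exact of_r_hi (hu.sup fun _ => hw) (hv.sup fun _ => hw) hhi
  rcases w with s | e
  · exact absurd (θ.refl s) hw
  obtain ⟨-, hmax⟩ := (hθ e).resolve_left hw
  have hiff : u ≤ eye e ↔ v ≤ eye e :=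
    ⟨le_eye_of_r hw hmax hu h, le_eye_of_r hw hmax hv (θ.symm h)⟩
  by_cases he : u ≤ eye e
  · rw [sup_eq_right.2 he, sup_eq_right.2 (hiff.1 he)]
    exact Or.inl rfl
  · exact of_r_hi (hu.sup fun h => absurd h he) (hv.sup fun h => absurd (hiff.2 h) he) hhi

end ExtendRel

/-- The extension of a congruence to the lattice with eyes. -/
def extendCon (θ : LatticeCon S) (hθ : IsExtendable A θ) : LatticeCon (WithEyes A) where
  r := ExtendRel θ
  iseqv := ⟨fun _ => Or.inl rfl, ExtendRel.symm, ExtendRel.trans⟩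
  inf {w x y z} h k := by
    refine (h.inf_right hθ y).trans ?_
    rw [inf_comm x y, inf_comm x z]
    exact k.inf_right hθ x
  sup {w x y z} h k := by
    refine (h.sup_right hθ y).trans ?_
    rw [sup_comm x y, sup_comm x z]
    exact k.sup_right hθ x

theorem extendCon_r_old_iff {hθ : IsExtendable A θ} {s t : S} :
    (extendCon θ hθ).r (old s) (old t) ↔ θ.r s t := by
  refine ⟨?_, fun h => Or.inr ⟨θ.refl _, θ.refl _, h⟩⟩
  rintro (h | ⟨-, -, h⟩)
  · cases h
    exact θ.refl _
  · exact h

/-- The restriction of a congruence of the lattice with eyes to the old elements. -/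
def restrict (θ : LatticeCon (WithEyes A)) : LatticeCon S where
  r s t := θ.r (old s) (old t)
  iseqv := ⟨fun _ => θ.refl _, θ.symm, θ.trans⟩
  inf h k := by simpa only [old_inf_old] using θ.inf h k
  sup h k := by simpa only [old_sup_old] using θ.sup h k

theorem isDiamond_eye {e : E} {a b : S} (hab : ¬a ≤ b) (hba : ¬b ≤ a) (hinf : a ⊓ b = A.lo e)
    (hsup : a ⊔ b = A.hi e) :
    IsDiamond (old (A.lo e)) (old a) (old b) (eye e : WithEyes A) (old (A.hi e)) := by
  have ha : ¬(old a : WithEyes A) ≤ eye e := by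
    simpa [← hinf] using hab
  have hb : ¬(old b : WithEyes A) ≤ eye e := by
    simpa [← hinf] using hba
  have ha' : ¬(eye e : WithEyes A) ≤ old a := by
    simpa [← hsup] using hba
  have hb' : ¬(eye e : WithEyes A) ≤ old b := by
    simpa [← hsup] using hab
  refine ⟨?_, ?_, ?_, ?_, ?_, ?_⟩
  · rw [old_inf_old, hinf]
  · rw [inf_eq_of_not_le hb hb', lo_old, lo_eye, ← hinf, inf_eq_right.2 inf_le_right]
  · rw [inf_eq_of_not_le ha' ha, lo_old, lo_eye, ← hinf, inf_eq_left.2 inf_le_left]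
  · rw [old_sup_old, hsup]
  · rw [sup_eq_of_not_le hb hb', hi_old, hi_eye, ← hsup, sup_eq_right.2 le_sup_right]
  · rw [sup_eq_of_not_le ha' ha, hi_old, hi_eye, ← hsup, sup_eq_left.2 le_sup_left]

section Diamonds

variable {θ : LatticeCon (WithEyes A)}

theorem restrict_r_of_r_eye {e : E} {a b : S}
    (he : IsDiamond (old (A.lo e)) (old a) (old b) (eye e : WithEyes A) (old (A.hi e)))
    (hv : eye e ≠ v) (h : θ.r (eye e) v) : (restrict θ).r (A.lo e) (A.hi e) := by
  by_cases hle : eye e ≤ v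
  · have hv : A.hi e ≤ v.lo := hle.resolve_left hv
    exact he.rotate.rotate.r_bot_top_of_r_top θ
      (latticeCon_r_of_le_of_le θ h le_rfl (eye_covBy_hi e).le (old_le.2 hv))
  · have hr : θ.r (eye e ⊓ v) (eye e) := by
      simpa only [inf_idem] using θ.inf (θ.refl (eye e)) (θ.symm h)
    have hlo : eye e ⊓ v ≤ old (A.lo e) := by
      rcases (inf_le_left : eye e ⊓ v ≤ eye e) with h | h
      exacts [absurd (inf_eq_left.1 h) hle, le_old.2 h]
    exact he.rotate.rotate.r_bot_top_of_r_bot θ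
      (latticeCon_r_of_le_of_le θ hr hlo (lo_covBy_eye e).le le_rfl)

theorem r_lo_of_collapses (hu : Collapses (restrict θ) u) : θ.r (old u.lo) u :=
  latticeCon_r_of_le_of_le θ hu le_rfl (old_le.2 le_rfl) (le_old.2 le_rfl)

theorem r_iff_extendRel_restrict
    (hA : ∀ e, ∃ a b,
      IsDiamond (old (A.lo e)) (old a) (old b) (eye e : WithEyes A) (old (A.hi e))) :
    θ.r u v ↔ ExtendRel (restrict θ) u v := by
  have collapses {u v : WithEyes A} (h : θ.r u v) (hne : u ≠ v) : Collapses (restrict θ) u := by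
    rcases u with s | e
    · exact θ.refl _
    · obtain ⟨a, b, he⟩ := hA e
      exact restrict_r_of_r_eye he hne h
  constructor
  · intro h
    by_cases hne : u = v
    · exact Or.inl hne
    have hu := collapses h hne
    have hv := collapses (θ.symm h) (Ne.symm hne)
    exact Or.inr ⟨hu, hv,
      θ.trans (r_lo_of_collapses hu) (θ.trans h (θ.symm (r_lo_of_collapses hv)))⟩
  · rintro (rfl | ⟨hu, hv, h⟩)
    · exact θ.refl _
    · exact θ.trans (θ.symm (r_lo_of_collapses hu)) (θ.trans h (r_lo_of_collapses hv))

end Diamonds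

end WithEyes

/-! ### Forked grids -/

/-- The data for a square grid with forks: its size and the positions of the forks on the
diagonal. -/
structure ForkPattern where
  size : ℕ
  forks : Set ℕ
  lt_size : ∀ {f}, f ∈ forks → f < size
  succ_notMem : ∀ {f}, f ∈ forks → f + 1 ∉ forks
  zero_notMem : 0 ∉ forks

namespace ForkPattern

variable (G : ForkPattern)

/-- The points of the grid `[0, size]²`, without those that lie strictly to the right of or
strictly above a diagonal point `(f, f)` with a fork. -/
@[ext]
structure Grid where
  x : ℕ
  y : ℕ
  x_le : x ≤ G.size
  y_le : y ≤ G.size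
  y_notMem : y < x → y ∉ G.forks
  x_notMem : x < y → x ∉ G.forks

open Classical in
/-- The smallest coordinate `≥ a` of a point of the grid whose other coordinate is at least `b`. -/
noncomputable def shift (a b : ℕ) : ℕ := if a ∈ G.forks ∧ a < b then a + 1 else a

theorem shift_le_iff {a b k : ℕ} :
    G.shift a b ≤ k ↔ a ≤ k ∧ (k ∈ G.forks → a < k ∨ b ≤ k) := by
  grind [shift]

theorem le_shift (a b : ℕ) : a ≤ G.shift a b := by
  grind [shift]

theorem shift_notMem {a b : ℕ} (h : G.shift a b < G.shift b a) : G.shift a b ∉ G.forks := by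
  have := @G.succ_notMem a
  grind [shift]

/-- The smallest grid point above `(a, b)`. -/
noncomputable def up (a b : ℕ) (ha : a ≤ G.size) (hb : b ≤ G.size) : G.Grid where
  x := G.shift a b
  y := G.shift b a
  x_le := G.shift_le_iff.2 ⟨ha, fun h => absurd (G.lt_size h) (lt_irrefl _)⟩
  y_le := G.shift_le_iff.2 ⟨hb, fun h => absurd (G.lt_size h) (lt_irrefl _)⟩
  x_notMem := G.shift_notMem
  y_notMem := G.shift_notMem

variable {G}

namespace Grid

variable {g h : G.Grid}

instance : PartialOrder G.Grid where
  le g h := g.x ≤ h.x ∧ g.y ≤ h.y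
  le_refl _ := ⟨le_rfl, le_rfl⟩
  le_trans _ _ _ h₁ h₂ := ⟨h₁.1.trans h₂.1, h₁.2.trans h₂.2⟩
  le_antisymm _ _ h₁ h₂ := Grid.ext (h₁.1.antisymm h₂.1) (h₁.2.antisymm h₂.2)

theorem le_def : g ≤ h ↔ g.x ≤ h.x ∧ g.y ≤ h.y := Iff.rfl

theorem lt_iff : g < h ↔ g.x ≤ h.x ∧ g.y ≤ h.y ∧ (g.x < h.x ∨ g.y < h.y) := by
  rw [lt_iff_le_not_ge, le_def, le_def]
  omega

instance : Finite G.Grid :=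
  Finite.of_injective (β := Set.Iic G.size × Set.Iic G.size)
    (fun g => (⟨g.x, g.x_le⟩, ⟨g.y, g.y_le⟩)) fun _ _ h =>
      Grid.ext (congrArg (fun p => (p.1 : ℕ)) h) (congrArg (fun p => (p.2 : ℕ)) h)

theorem up_le_iff {a b : ℕ} {ha : a ≤ G.size} {hb : b ≤ G.size} :
    G.up a b ha hb ≤ g ↔ a ≤ g.x ∧ b ≤ g.y := by
  have hx := g.x_notMem
  have hy := g.y_notMem
  rw [le_def]
  change G.shift a b ≤ g.x ∧ G.shift b a ≤ g.y ↔ _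
  grind [shift_le_iff]

noncomputable instance : Lattice G.Grid where
  inf g h :=
    { x := min g.x h.x
      y := min g.y h.y
      x_le := min_le_of_left_le g.x_le
      y_le := min_le_of_left_le g.y_le
      x_notMem := by grind [g.x_notMem, h.x_notMem]
      y_notMem := by grind [g.y_notMem, h.y_notMem] }
  sup g h := G.up (max g.x h.x) (max g.y h.y) (max_le g.x_le h.x_le) (max_le g.y_le h.y_le)
  inf_le_left g h := ⟨min_le_left _ _, min_le_left _ _⟩
  inf_le_right g h := ⟨min_le_right _ _, min_le_right _ _⟩
  le_inf _ _ _ h₁ h₂ := ⟨le_min h₁.1 h₂.1, le_min h₁.2 h₂.2⟩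
  le_sup_left _ _ :=
    ⟨(le_max_left _ _).trans (G.le_shift _ _), (le_max_left _ _).trans (G.le_shift _ _)⟩
  le_sup_right _ _ :=
    ⟨(le_max_right _ _).trans (G.le_shift _ _), (le_max_right _ _).trans (G.le_shift _ _)⟩
  sup_le _ _ _ h₁ h₂ := up_le_iff.2 ⟨max_le h₁.1 h₂.1, max_le h₁.2 h₂.2⟩

@[simp] theorem inf_x (g h : G.Grid) : (g ⊓ h).x = min g.x h.x := rfl
@[simp] theorem inf_y (g h : G.Grid) : (g ⊓ h).y = min g.y h.y := rfl
theorem sup_x (g h : G.Grid) : (g ⊔ h).x = G.shift (max g.x h.x) (max g.y h.y) := rfl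
theorem sup_y (g h : G.Grid) : (g ⊔ h).y = G.shift (max g.y h.y) (max g.x h.x) := rfl

theorem sup_eq_of_le {a b : G.Grid} (ha : a ≤ g) (hb : b ≤ g) (hx : g.x ≤ a.x) (hy : g.y ≤ b.y) :
    a ⊔ b = g :=
  le_antisymm (sup_le ha hb)
    ⟨hx.trans (le_def.1 le_sup_left).1, hy.trans (le_def.1 le_sup_right).2⟩

instance : BoundedOrder G.Grid where
  top := ⟨G.size, G.size, le_rfl, le_rfl, fun h => absurd h (lt_irrefl _),
    fun h => absurd h (lt_irrefl _)⟩
  bot := ⟨0, 0, zero_le, zero_le, fun h => absurd h (lt_irrefl _),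
    fun h => absurd h (lt_irrefl _)⟩
  le_top g := ⟨g.x_le, g.y_le⟩
  bot_le _ := ⟨zero_le, zero_le⟩

@[simp] theorem top_x : (⊤ : G.Grid).x = G.size := rfl
@[simp] theorem top_y : (⊤ : G.Grid).y = G.size := rfl
@[simp] theorem bot_x : (⊥ : G.Grid).x = 0 := rfl
@[simp] theorem bot_y : (⊥ : G.Grid).y = 0 := rfl

/-- The reflection of the grid in its diagonal. -/
@[simps apply_x]
def swap : G.Grid ≃o G.Grid where
  toFun g := ⟨g.y, g.x, g.y_le, g.x_le, g.x_notMem, g.y_notMem⟩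
  invFun g := ⟨g.y, g.x, g.y_le, g.x_le, g.x_notMem, g.y_notMem⟩
  left_inv _ := rfl
  right_inv _ := rfl
  map_rel_iff' := and_comm

/-! #### Coverings of the grid -/

theorem covBy_up_right (hg : g.x < G.size) : g ⋖ G.up (g.x + 1) g.y hg g.y_le := by
  constructor
  · exact lt_iff.2 ⟨Nat.le_of_succ_le (G.le_shift _ _), G.le_shift _ _, Or.inl (G.le_shift _ _)⟩
  · intro w hgw hw
    have hwx : w.x = g.x := by
      by_contra h
      exact hw.not_ge (up_le_iff.2 ⟨hgw.le.1.lt_of_ne (Ne.symm h), hgw.le.2⟩)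
    have hgy : g.y < w.y := by
      have := lt_iff.1 hgw
      omega
    have hwy : w.y ≤ G.shift g.y (g.x + 1) := hw.le.2
    -- so the fork that raises `(g.x + 1, g.y)` sits at `g = (g.y, g.y)`, and `w` lies above it
    have := g.y_notMem
    have := w.x_notMem
    grind [shift]

theorem covBy_up_left (hg : g.y < G.size) : g ⋖ G.up g.x (g.y + 1) g.x_le hg :=
  (apply_covBy_apply_iff swap).1 (covBy_up_right (g := swap g) hg)

theorem exists_up_of_covBy (hgh : g ⋖ h) :
    (∃ hs, h = G.up (g.x + 1) g.y hs g.y_le) ∨ ∃ hs, h = G.up g.x (g.y + 1) g.x_le hs := by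
  obtain ⟨hx, hy, hlt | hlt⟩ := lt_iff.1 hgh.lt
  · have hc := covBy_up_right (hlt.trans_le h.x_le)
    exact Or.inl ⟨_, ((hgh.eq_or_eq hc.le (up_le_iff.2 ⟨hlt, hy⟩)).resolve_left hc.lt.ne').symm⟩
  · have hc := covBy_up_left (hlt.trans_le h.y_le)
    exact Or.inr ⟨_, ((hgh.eq_or_eq hc.le (up_le_iff.2 ⟨hx, hlt⟩)).resolve_left hc.lt.ne').symm⟩

instance : IsUpperModularLattice G.Grid where
  covBy_sup_of_inf_covBy := by
    intro u v h
    have hle : u ⊓ v ≤ v := inf_le_right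
    have huv : ¬u ≤ v := fun h' => (inf_eq_left.2 h' ▸ h).lt.false
    generalize u ⊓ v = o at h hle
    obtain ⟨hx, hy⟩ := hle
    rcases exists_up_of_covBy h with ⟨hs, rfl⟩ | ⟨hs, rfl⟩ <;> rw [up_le_iff] at huv
    · have hvx : v.x = o.x := by grind
      have : G.up (o.x + 1) o.y hs o.y_le ⊔ v = G.up (v.x + 1) v.y (hvx ▸ hs) v.y_le :=
        eq_of_forall_ge_iff fun w => by
          rw [sup_le_iff, up_le_iff, up_le_iff, le_def]
          grind
      exact this ▸ covBy_up_right _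
    · have hvy : v.y = o.y := by grind
      have : G.up o.x (o.y + 1) o.x_le hs ⊔ v = G.up v.x (v.y + 1) v.x_le (hvy ▸ hs) :=
        eq_of_forall_ge_iff fun w => by
          rw [sup_le_iff, up_le_iff, up_le_iff, le_def]
          grind
      exact this ▸ covBy_up_left _

/-! #### The sides of the grid -/

/-- The points `(k, 0)` of the grid, constant for `k ≥ size`. -/
@[simps]
def base (G : ForkPattern) (k : ℕ) : G.Grid where
  x := min k G.size
  y := 0
  x_le := min_le_right _ _
  y_le := zero_le
  y_notMem _ := G.zero_notMem
  x_notMem h := absurd h (Nat.not_lt_zero _)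

/-- The points `(0, k)` of the grid, constant for `k ≥ size`. -/
def side (G : ForkPattern) (k : ℕ) : G.Grid := swap (base G k)

@[simp] theorem side_x (k : ℕ) : (side G k).x = 0 := rfl
@[simp] theorem side_y (k : ℕ) : (side G k).y = min k G.size := rfl

theorem base_mono : Monotone (base G) := fun _ _ h => ⟨min_le_min_right _ h, le_rfl⟩

theorem side_mono : Monotone (side G) := swap.monotone.comp base_mono

theorem inf_base_size (g : G.Grid) : g ⊓ base G G.size = base G g.x :=
  Grid.ext (by simp) (by simp)

theorem inf_side_size (g : G.Grid) : g ⊓ side G G.size = side G g.y :=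
  Grid.ext (by simp) (by simp)

theorem base_sup_side (g : G.Grid) : base G g.x ⊔ side G g.y = g :=
  sup_eq_of_le ⟨min_le_left _ _, zero_le⟩ ⟨zero_le, min_le_left _ _⟩ (le_min le_rfl g.x_le)
    (le_min le_rfl g.y_le)

theorem mem_forks_of_infIrred (hx : g.x < G.size) (hy : g.y < G.size) (hg : InfIrred g) :
    g.x = g.y ∧ g.x ∈ G.forks := by
  have h := eq_of_infIrred_of_covBy hg (covBy_up_right hx) (covBy_up_left hy)
  have h₁ : g.x + 1 ≤ G.shift g.x (g.y + 1) := (up_le_iff.1 h.le).1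
  have h₂ : g.y + 1 ≤ G.shift g.y (g.x + 1) := (up_le_iff.1 h.ge).2
  have := g.x_notMem
  have := g.y_notMem
  grind [shift]

theorem not_supIrred_of_mem_forks (hxy : g.x = g.y) (hg : g.x ∈ G.forks) : ¬SupIrred g := by
  intro h
  obtain ⟨f, hf⟩ : ∃ f, g.x = f + 1 :=
    Nat.exists_eq_succ_of_ne_zero fun h0 => G.zero_notMem (h0 ▸ hg)
  have hf' : f ∉ G.forks := fun h => G.succ_notMem h (hf ▸ hg)
  have hs : f + 1 ≤ G.size := hf ▸ g.x_le
  let a : G.Grid := ⟨f + 1, f, hs, Nat.le_of_succ_le hs, fun _ => hf', by lia⟩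
  have ha : a ≤ g := ⟨hf.ge, by simp only [a]; lia⟩
  have ha' : swap a ≤ g := ⟨by simp only [a, swap_apply_x]; lia, hxy ▸ hf.ge⟩
  rcases h.2 (sup_eq_of_le ha ha' hf.le (hxy ▸ hf.le)) with h | h
  · exact f.succ_ne_self (hf.symm.trans (hxy.trans (congrArg Grid.y h).symm))
  · exact f.succ_ne_self (hf.symm.trans (congrArg Grid.x h).symm)

theorem eq_base_of_supIrred (hx : g.x = G.size) (hy : g.y < G.size) (hg : SupIrred g) :
    g = base G G.size := by
  let a : G.Grid := ⟨g.x - 1, g.y, (Nat.sub_le _ _).trans g.x_le, g.y_le,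
    fun _ => g.y_notMem (by lia), by lia⟩
  have hsup : base G G.size ⊔ a = g :=
    sup_eq_of_le ⟨by simp [hx], zero_le⟩ ⟨Nat.sub_le _ _, le_rfl⟩ (by simp [hx]) le_rfl
  refine ((hg.2 hsup).resolve_right fun h => ?_).symm
  have : g.x - 1 = g.x := congrArg Grid.x h
  lia

theorem eq_base_or_eq_side_of_irred (hs : SupIrred g) (hi : InfIrred g) :
    g = base G G.size ∨ g = side G G.size := by
  rcases g.x_le.eq_or_lt with hx | hx <;> rcases g.y_le.eq_or_lt with hy | hy
  · exact absurd (fun u _ => ⟨u.x_le.trans hx.ge, u.y_le.trans hy.ge⟩) hi.1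
  · exact Or.inl (eq_base_of_supIrred hx hy hs)
  · right
    rw [side, ← swap.symm_apply_eq]
    exact eq_base_of_supIrred hy hx ((supIrred_apply_iff swap.symm).2 hs)
  · obtain ⟨hxy, hg⟩ := mem_forks_of_infIrred hx hy hi
    exact absurd hs (not_supIrred_of_mem_forks hxy hg)

/-! #### Congruences of the grid -/

section Congruences

variable (ρ : LatticeCon G.Grid)

theorem r_iff_base_side :
    ρ.r g h ↔ ρ.r (base G g.x) (base G h.x) ∧ ρ.r (side G g.y) (side G h.y) := by
  constructor
  · intro hr
    rw [← inf_base_size g, ← inf_base_size h, ← inf_side_size g, ← inf_side_size h]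
    exact ⟨ρ.inf hr (ρ.refl _), ρ.inf hr (ρ.refl _)⟩
  · rintro ⟨hb, hs⟩
    simpa only [base_sup_side] using ρ.sup hb hs

theorem r_base_succ_of_mem_forks {k : ℕ} (hk : k + 1 ∈ G.forks)
    (hr : ρ.r (base G k) (base G (k + 1))) : ρ.r (base G (k + 1)) (base G (k + 2)) := by
  have hs := G.lt_size hk
  have hk' : k ∉ G.forks := fun h => G.succ_notMem h hk
  have h₁ : (base G k ⊔ side G (k + 2)) ⊓ base G (k + 2) = base G k := by
    ext
    · simp only [inf_x, sup_x, base_x, side_x, base_y, side_y]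
      grind [shift]
    · simp
  have h₂ : (base G (k + 1) ⊔ side G (k + 2)) ⊓ base G (k + 2) = base G (k + 2) := by
    ext
    · simp only [inf_x, sup_x, base_x, side_x, base_y, side_y]
      grind [shift]
    · simp
  have h := ρ.inf (ρ.sup hr (ρ.refl (side G (k + 2)))) (ρ.refl (base G (k + 2)))
  rw [h₁, h₂] at h
  exact latticeCon_r_of_le_of_le ρ h (base_mono k.le_succ) (base_mono (k + 1).le_succ) le_rfl

/-- The congruence of the grid that collapses the `k`-th lines, between the coordinates `k` and
`k + 1`, for `k` in `s`. -/
def con (s : Set ℕ) (hs : ∀ k, k + 1 ∈ G.forks → k ∈ s → k + 1 ∈ s) : LatticeCon G.Grid where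
  r g h := ∀ k ∉ s, (g.x ≤ k ↔ h.x ≤ k) ∧ (g.y ≤ k ↔ h.y ≤ k)
  iseqv := {
    refl _ _ _ := ⟨Iff.rfl, Iff.rfl⟩
    symm h k hk := ⟨(h k hk).1.symm, (h k hk).2.symm⟩
    trans h₁ h₂ k hk := ⟨(h₁ k hk).1.trans (h₂ k hk).1, (h₁ k hk).2.trans (h₂ k hk).2⟩ }
  inf h₁ h₂ k hk := by
    simp only [inf_x, inf_y, min_le_iff]
    exact ⟨or_congr (h₁ k hk).1 (h₂ k hk).1, or_congr (h₁ k hk).2 (h₂ k hk).2⟩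
  sup h₁ h₂ k hk := by
    have hx := and_congr (h₁ k hk).1 (h₂ k hk).1
    have hy := and_congr (h₁ k hk).2 (h₂ k hk).2
    simp only [sup_x, sup_y, shift_le_iff, max_le_iff, max_lt_iff, hx, hy]
    by_cases hf : k ∈ G.forks
    · obtain ⟨m, rfl⟩ : ∃ m, k = m + 1 :=
        Nat.exists_eq_succ_of_ne_zero fun h0 => G.zero_notMem (h0 ▸ hf)
      have hm : m ∉ s := fun hm => hk (hs m hf hm)
      simp only [Nat.lt_succ_iff, (h₁ m hm).1, (h₁ m hm).2, (h₂ m hm).1, (h₂ m hm).2, and_self]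
    · simp only [hf, false_imp_iff, and_self]

theorem con_r_base_iff {s : Set ℕ} {hs : ∀ k, k + 1 ∈ G.forks → k ∈ s → k + 1 ∈ s} {k : ℕ}
    (hk : k < G.size) : (con s hs).r (base G k) (base G (k + 1)) ↔ k ∈ s := by
  constructor
  · intro h
    by_contra hks
    have := (h k hks).1
    simp only [base_x] at this
    lia
  · intro hks j hj
    have : j ≠ k := by
      rintro rfl
      exact hj hks
    simp only [base_x, base_y]
    lia

end Congruences

end Grid

end ForkPattern

/-! ### Coloured forked grids with eyes -/

/-- A forked grid whose lines (the `k`-th one lies between the coordinates `k` and `k + 1`) are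
coloured by a preordered set `P`. The first `free` lines show all colours and have no forks; the
forks show all pairs of comparable colours. -/
structure GridColoring (P : Type*) [Preorder P] extends ForkPattern where
  color : ℕ → P
  free : ℕ
  free_le_size : free ≤ size
  free_lt : ∀ {f}, f ∈ forks → free < f
  exists_color : ∀ p, ∃ k < free, color k = p
  color_succ_le : ∀ {k}, k + 1 ∈ forks → color (k + 1) ≤ color k
  exists_fork : ∀ {p q}, p ≤ q → ∃ k, k + 1 ∈ forks ∧ color k = q ∧ color (k + 1) = p

namespace GridColoring

open ForkPattern ForkPattern.Grid WithEyes

variable {P : Type*} [Preorder P] (C : GridColoring P)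

theorem size_pos : 0 < C.size := by
  obtain ⟨k, hk, -⟩ := C.exists_color (C.color 0)
  exact k.zero_le.trans_lt (hk.trans_le C.free_le_size)

/-- The points of the grid with a free coordinate. -/
def point (a b : ℕ) (ha : a ≤ C.size) (hb : b ≤ C.size) (h : a ≤ C.free ∨ b ≤ C.free) :
    C.Grid where
  x := a
  y := b
  x_le := ha
  y_le := hb
  x_notMem hab hf := by
    have := C.free_lt hf
    lia
  y_notMem hba hf := by
    have := C.free_lt hf
    lia

/-- The cells of the grid that get an eye: those with a free side and with sides of the same
colour. -/
@[ext]
structure Cell where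
  i : ℕ
  j : ℕ
  i_lt : i < C.size
  j_lt : j < C.size
  free_or : i < C.free ∨ j < C.free
  color_eq : C.color i = C.color j

variable {C}

@[simp] theorem point_x {a b : ℕ} {ha : a ≤ C.size} {hb : b ≤ C.size}
    {h : a ≤ C.free ∨ b ≤ C.free} : (C.point a b ha hb h).x = a := rfl

@[simp] theorem point_y {a b : ℕ} {ha : a ≤ C.size} {hb : b ≤ C.size}
    {h : a ≤ C.free ∨ b ≤ C.free} : (C.point a b ha hb h).y = b := rfl

theorem up_eq_point {a b : ℕ} (ha : a ≤ C.size) (hb : b ≤ C.size)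
    (h : a ≤ C.free ∨ b ≤ C.free) : C.up a b ha hb = C.point a b ha hb h :=
  eq_of_forall_ge_iff fun _ => up_le_iff

namespace Cell

instance : Finite C.Cell :=
  Finite.of_injective (β := Set.Iio C.size × Set.Iio C.size)
    (fun e => (⟨e.i, e.i_lt⟩, ⟨e.j, e.j_lt⟩)) fun _ _ h =>
      Cell.ext (congrArg (fun p => (p.1 : ℕ)) h) (congrArg (fun p => (p.2 : ℕ)) h)

/-- The reflection of a cell in the diagonal of the grid. -/
def swap : C.Cell ≃ C.Cell where
  toFun e := ⟨e.j, e.i, e.j_lt, e.i_lt, e.free_or.symm, e.color_eq.symm⟩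
  invFun e := ⟨e.j, e.i, e.j_lt, e.i_lt, e.free_or.symm, e.color_eq.symm⟩
  left_inv _ := rfl
  right_inv _ := rfl

/-- The lowest corner of a cell. -/
def bot (e : C.Cell) : C.Grid :=
  C.point e.i e.j e.i_lt.le e.j_lt.le (e.free_or.imp le_of_lt le_of_lt)

/-- The left corner of a cell. -/
def left (e : C.Cell) : C.Grid :=
  C.point (e.i + 1) e.j e.i_lt e.j_lt.le (e.free_or.imp id le_of_lt)

/-- The right corner of a cell. -/
def right (e : C.Cell) : C.Grid :=
  C.point e.i (e.j + 1) e.i_lt.le e.j_lt (e.free_or.imp le_of_lt id)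

/-- The highest corner of a cell. -/
def top (e : C.Cell) : C.Grid :=
  C.point (e.i + 1) (e.j + 1) e.i_lt e.j_lt e.free_or

variable (e : C.Cell)

theorem up_bot_right : C.up (e.bot.x + 1) e.bot.y e.i_lt e.j_lt.le = e.left := up_eq_point _ _ _

theorem up_bot_left : C.up e.bot.x (e.bot.y + 1) e.i_lt.le e.j_lt = e.right := up_eq_point _ _ _

theorem bot_covBy_left : e.bot ⋖ e.left := e.up_bot_right ▸ covBy_up_right e.i_lt

theorem left_covBy_top : e.left ⋖ e.top := by
  have := covBy_up_left (g := e.left) e.j_lt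
  rwa [show C.up e.left.x (e.left.y + 1) _ _ = e.top from up_eq_point _ _ _] at this

theorem right_covBy_top : e.right ⋖ e.top := by
  have := covBy_up_right (g := e.right) e.i_lt
  rwa [show C.up (e.right.x + 1) e.right.y _ _ = e.top from up_eq_point _ _ _] at this

theorem left_inf_right : e.left ⊓ e.right = e.bot :=
  Grid.ext (min_eq_right e.i.le_succ) (min_eq_left e.j.le_succ)

theorem left_sup_right : e.left ⊔ e.right = e.top :=
  sup_eq_of_le e.left_covBy_top.le e.right_covBy_top.le le_rfl le_rfl

end Cell

variable (C) in
/-- The eyes of a coloured grid, one in each cell of `GridColoring.Cell`. -/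
def eyes : EyeFamily C.Grid C.Cell where
  lo := Cell.bot
  hi := Cell.top
  lo_lt_hi e := e.bot_covBy_left.lt.trans e.left_covBy_top.lt

@[simp] theorem eyes_lo (e : C.Cell) : C.eyes.lo e = e.bot := rfl
@[simp] theorem eyes_hi (e : C.Cell) : C.eyes.hi e = e.top := rfl

theorem isShort_eyes : IsShort C.eyes := by
  intro e s hs
  rcases exists_up_of_covBy hs with ⟨_, rfl⟩ | ⟨_, rfl⟩
  · exact e.up_bot_right ▸ e.left_covBy_top
  · exact e.up_bot_left ▸ e.right_covBy_top

variable (C) in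
/-- The lattice of a coloured grid: the forked grid together with its eyes. -/
abbrev Lat : Type := WithEyes C.eyes

instance : IsUpperModularLattice C.Lat :=
  isUpperModularLattice isShort_eyes fun _ _ h =>
    Cell.ext (congrArg Grid.x h) (congrArg Grid.y h)

/-! #### The diagram -/

theorem natCast_add_le_natCast_add_iff {a c : ℕ} {s t : ℝ} (hs : s ∈ Set.Ico (0 : ℝ) 1)
    (ht : t ∈ Set.Ico (0 : ℝ) 1) : a + s ≤ c + t ↔ a < c ∨ a = c ∧ s ≤ t := by
  obtain ⟨hs₀, hs₁⟩ := hs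
  obtain ⟨ht₀, ht₁⟩ := ht
  rcases lt_trichotomy a c with h | rfl | h
  · have : (a : ℝ) + 1 ≤ c := by exact_mod_cast h
    exact iff_of_true (by linarith) (Or.inl h)
  · simp
  · have : (c : ℝ) + 1 ≤ a := by exact_mod_cast h
    exact iff_of_false (by linarith) (by lia)

/-- The offset of the eyes in the `n`-th cells of a row. As it decreases with `n`, different eyes of
a row or column of cells are incomparable. -/
noncomputable def eyeOffset (n : ℕ) : ℝ := 1 / (n + 2)

theorem eyeOffset_pos (n : ℕ) : 0 < eyeOffset n := by
  unfold eyeOffset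
  positivity

theorem eyeOffset_le_half (n : ℕ) : eyeOffset n ≤ 1 / 2 :=
  one_div_le_one_div_of_le two_pos (le_add_of_nonneg_left n.cast_nonneg)

theorem eyeOffset_le_eyeOffset_iff {m n : ℕ} : eyeOffset m ≤ eyeOffset n ↔ n ≤ m := by
  rw [eyeOffset, eyeOffset, one_div_le_one_div (by positivity) (by positivity)]
  simp

theorem eyeOffset_mem_Ico (n : ℕ) : eyeOffset n ∈ Set.Ico (0 : ℝ) 1 :=
  ⟨(eyeOffset_pos n).le, (eyeOffset_le_half n).trans_lt one_half_lt_one⟩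

/-- The coordinates of an element of the lattice, before they are turned by `planeTurn`. -/
noncomputable def coord : C.Lat → ℝ × ℝ
  | .old g => (g.x, g.y)
  | .eye e => (e.i + eyeOffset e.j, e.j + eyeOffset e.i)

theorem coord_le_coord {u v : C.Lat} : coord u ≤ coord v ↔ u ≤ v := by
  have cast_le_add {a c n : ℕ} : (a : ℝ) ≤ c + eyeOffset n ↔ a ≤ c := by
    simpa [(eyeOffset_pos n).le, le_iff_lt_or_eq] using natCast_add_le_natCast_add_iff (a := a)
      (c := c) ⟨le_rfl, one_pos⟩ (eyeOffset_mem_Ico n)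
  have add_le_cast {a c n : ℕ} : (a : ℝ) + eyeOffset n ≤ c ↔ a + 1 ≤ c := by
    simpa [(eyeOffset_pos n).not_ge] using natCast_add_le_natCast_add_iff (a := a) (c := c)
      (eyeOffset_mem_Ico n) ⟨le_rfl, one_pos⟩
  rcases u with g | e <;> rcases v with h | f
  · simp [coord, le_def]
  · simp [coord, le_def, cast_le_add, Cell.bot]
  · simp [coord, le_def, add_le_cast, Cell.top]
  · simp only [coord, Prod.mk_le_mk, eye_le_eye, eyes_lo, eyes_hi, le_def, Cell.ext_iff, Cell.bot,
      Cell.top, point_x, point_y, eyeOffset_le_eyeOffset_iff,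
      natCast_add_le_natCast_add_iff (eyeOffset_mem_Ico _) (eyeOffset_mem_Ico _)]
    lia

variable (C) in
/-- The coordinates as an order embedding. -/
noncomputable def coordEmbedding : C.Lat ↪o ℝ × ℝ :=
  OrderEmbedding.ofMapLEIff coord fun _ _ => coord_le_coord

theorem coordEmbedding_old (g : C.Grid) : C.coordEmbedding (old g) = (↑g.x, ↑g.y) := rfl

theorem coordEmbedding_eye (e : C.Cell) :
    C.coordEmbedding (eye e) = (e.i + eyeOffset e.j, e.j + eyeOffset e.i) := rfl

theorem coordEmbedding_bot : C.coordEmbedding ⊥ = 0 := by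
  simp [bot_def, coordEmbedding_old]

theorem coordEmbedding_top : C.coordEmbedding ⊤ = (↑C.size, ↑C.size) := by
  simp [top_def, coordEmbedding_old]

theorem coordEmbedding_mem_Icc (u : C.Lat) :
    C.coordEmbedding u ∈ Set.Icc (0 : ℝ × ℝ) (↑C.size, ↑C.size) := by
  rw [← coordEmbedding_bot (C := C), ← coordEmbedding_top]
  exact ⟨C.coordEmbedding.monotone bot_le, C.coordEmbedding.monotone le_top⟩

variable (C) in
/-- The planar diagram of the lattice. -/
noncomputable def diagram : PlanarDiagram C.Lat :=
  PlanarDiagram.ofOrderEmbedding C.coordEmbedding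

theorem eye_notMem_leftBoundary (e : C.Cell) : eye e ∉ C.diagram.leftBoundary := by
  -- the point at the same height on the lower left edge of the cell
  have hq : ((e.i + (eyeOffset e.j + eyeOffset e.i), e.j) : ℝ × ℝ) ∈
      segment ℝ (C.coordEmbedding (old e.bot)) (C.coordEmbedding (old e.left)) := by
    have := eyeOffset_pos e.i
    have := eyeOffset_pos e.j
    have := eyeOffset_le_half e.i
    have := eyeOffset_le_half e.j
    rw [segment_eq_image']
    refine ⟨eyeOffset e.j + eyeOffset e.i, ⟨by linarith, by linarith⟩, ?_⟩
    simp [coordEmbedding_old, Cell.bot, Cell.left]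
  refine PlanarDiagram.notMem_leftBoundary (PlanarDiagram.planeTurn_mem_support_of_covBy
    (old_covBy_old isShort_eyes e.bot_covBy_left) hq) ?_ ?_ <;> rw [coordEmbedding_eye]
  · ring
  · linarith [eyeOffset_pos e.i]

/-! #### The corners -/

variable (C) in
/-- The left corner of the lattice. -/
noncomputable def leftCorner : C.Lat := old (base C.toForkPattern C.size)

variable (C) in
/-- The right corner of the lattice. -/
noncomputable def rightCorner : C.Lat := old (side C.toForkPattern C.size)

theorem coordEmbedding_leftCorner : C.coordEmbedding C.leftCorner = (↑C.size, 0) := by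
  simp [leftCorner, coordEmbedding_old]

theorem coordEmbedding_rightCorner : C.coordEmbedding C.rightCorner = (0, ↑C.size) := by
  simp [rightCorner, coordEmbedding_old]

theorem isCompl_leftCorner_rightCorner : IsCompl C.leftCorner C.rightCorner := by
  apply isCompl_of_map_inf_of_map_sup C.coordEmbedding <;>
    simp [coordEmbedding_leftCorner, coordEmbedding_rightCorner, coordEmbedding_bot,
      coordEmbedding_top, Prod.zero_eq_mk]

theorem isLeftCorner_leftCorner : C.diagram.IsLeftCorner C.leftCorner := by
  have hsize : (C.size : ℝ) ≠ 0 := Nat.cast_ne_zero.2 C.size_pos.ne'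
  refine PlanarDiagram.isLeftCorner_of_eq_corner coordEmbedding_mem_Icc coordEmbedding_leftCorner
    ?_ ?_
  · rw [isMin_iff_eq_bot, ← C.coordEmbedding.injective.eq_iff, coordEmbedding_leftCorner,
      coordEmbedding_bot]
    simpa using hsize
  · rw [isMax_iff_eq_top, ← C.coordEmbedding.injective.eq_iff, coordEmbedding_leftCorner,
      coordEmbedding_top]
    simpa using hsize.symm

theorem rightCorner_notMem_leftBoundary : C.rightCorner ∉ C.diagram.leftBoundary := by
  have hsize : (0 : ℝ) < C.size := Nat.cast_pos.2 C.size_pos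
  refine PlanarDiagram.notMem_leftBoundary (Or.inl ⟨C.leftCorner, rfl⟩) ?_ ?_ <;>
    simp [coordEmbedding_leftCorner, coordEmbedding_rightCorner, hsize]

theorem isLeftCorner_iff (u : C.Lat) : C.diagram.IsLeftCorner u ↔ u = C.leftCorner := by
  refine ⟨?_, fun h => h ▸ isLeftCorner_leftCorner⟩
  rintro ⟨hs, hi, hb⟩
  rcases u with g | e
  · rcases eq_base_or_eq_side_of_irred (supIrred_of_old hs) (infIrred_of_old hi) with rfl | rfl
    · rfl
    · exact absurd hb rightCorner_notMem_leftBoundary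
  · exact absurd hb (eye_notMem_leftBoundary e)

/-- The reflection of the lattice in the vertical axis. -/
def reflect : C.Lat ≃o C.Lat where
  toFun
    | .old g => old (Grid.swap g)
    | .eye e => eye (Cell.swap e)
  invFun
    | .old g => old (Grid.swap g)
    | .eye e => eye (Cell.swap e)
  left_inv u := by cases u <;> rfl
  right_inv u := by cases u <;> rfl
  map_rel_iff' {u v} := by
    rw [← coord_le_coord, ← coord_le_coord (u := u)]
    cases u <;> cases v <;> exact and_comm

theorem coordEmbedding_reflect (u : C.Lat) :
    C.coordEmbedding (reflect u) = (C.coordEmbedding u).swap := by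
  cases u <;> rfl

theorem isRightCorner_iff (u : C.Lat) : C.diagram.IsRightCorner u ↔ u = C.rightCorner := by
  rw [diagram, PlanarDiagram.isRightCorner_iff_of_swap coordEmbedding_reflect]
  exact (isLeftCorner_iff _).trans reflect.eq_symm_apply.symm

variable (C) in
theorem isRectangularLattice : IsRectangularLattice C.Lat :=
  ⟨inferInstance, inferInstance, C.diagram, C.leftCorner, C.rightCorner, isLeftCorner_iff,
    isRightCorner_iff, isCompl_leftCorner_rightCorner⟩

/-! #### Congruences -/

variable (C) in
/-- The congruence of the grid that collapses the lines with a colour in `I`. -/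
noncomputable def gridCon (I : LowerSet P) : LatticeCon C.Grid :=
  Grid.con (C.color ⁻¹' I) fun _ hk hI => I.lower (C.color_succ_le hk) hI

theorem isExtendable_gridCon (I : LowerSet P) : IsExtendable C.eyes (C.gridCon I) := by
  intro e
  by_cases hI : C.color e.i ∈ I
  · left
    intro k hk
    have hi : k ≠ e.i := by
      rintro rfl
      exact hk hI
    have hj : k ≠ e.j := by
      rintro rfl
      exact hk (Set.mem_preimage.2 (e.color_eq ▸ hI))
    simp only [eyes_lo, eyes_hi, Cell.bot, Cell.top, point_x, point_y]
    lia
  · have hJ : C.color e.j ∉ I := e.color_eq ▸ hI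
    refine Or.inr ⟨fun s hs => ?_, fun s hs => ?_⟩ <;>
    · have hi := (hs e.i hI).1
      have hj := (hs e.j hJ).2
      simp only [eyes_lo, eyes_hi, Cell.bot, Cell.top, point_x, point_y, le_def] at hi hj ⊢
      lia

variable (C) in
/-- The congruence that collapses the lines with a colour in `I`. -/
noncomputable def con (I : LowerSet P) : LatticeCon C.Lat :=
  extendCon (C.gridCon I) (isExtendable_gridCon I)

theorem con_le_con_iff {I J : LowerSet P} : C.con I ≤ C.con J ↔ I ≤ J := by
  constructor
  · intro h p hp
    obtain ⟨k, hk, rfl⟩ := C.exists_color p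
    have hk' := hk.trans_le C.free_le_size
    have hI : (C.con I).r (old (base _ k)) (old (base _ (k + 1))) :=
      extendCon_r_old_iff.2 ((con_r_base_iff hk').2 hp)
    exact (con_r_base_iff hk').1 (extendCon_r_old_iff.1 (h hI))
  · intro h u v
    exact ExtendRel.mono fun g g' hg k hk => hg k fun hI => hk (h hI)

variable (θ : LatticeCon C.Lat)

theorem isDiamond_eyes (e : C.Cell) :
    IsDiamond (old e.bot) (old e.left) (old e.right) (eye e : C.Lat) (old e.top) :=
  isDiamond_eye (fun h => e.i.lt_irrefl h.1) (fun h => e.j.lt_irrefl h.2) e.left_inf_right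
    e.left_sup_right

theorem restrict_r_base_iff_r_side (e : C.Cell) :
    (restrict θ).r (base _ e.i) (base _ (e.i + 1)) ↔
      (restrict θ).r (side _ e.j) (side _ (e.j + 1)) := by
  have hl : (restrict θ).r e.bot e.left ↔ (restrict θ).r (base _ e.i) (base _ (e.i + 1)) :=
    (r_iff_base_side _).trans (and_iff_left ((restrict θ).refl _))
  have hr : (restrict θ).r e.bot e.right ↔ (restrict θ).r (side _ e.j) (side _ (e.j + 1)) :=
    (r_iff_base_side _).trans (and_iff_right ((restrict θ).refl _))
  have he := isDiamond_eyes e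
  exact hl.symm.trans ((he.r_bot_iff θ).trans ((he.rotate.r_bot_iff θ).symm.trans hr))

theorem restrict_r_side_iff_of_color_eq {k l : ℕ} (hk : k < C.size) (hl : l < C.size)
    (h : C.color k = C.color l) :
    (restrict θ).r (side _ k) (side _ (k + 1)) ↔ (restrict θ).r (base _ l) (base _ (l + 1)) := by
  obtain ⟨m, hm, hmc⟩ := C.exists_color (C.color k)
  have hm' := hm.trans_le C.free_le_size
  have hmk := restrict_r_base_iff_r_side θ ⟨m, k, hm', hk, Or.inl hm, hmc⟩
  have hmm := restrict_r_base_iff_r_side θ ⟨m, m, hm', hm', Or.inl hm, rfl⟩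
  have hlm := restrict_r_base_iff_r_side θ ⟨l, m, hl, hm', Or.inr hm, (hmc.trans h).symm⟩
  exact hmk.symm.trans (hmm.trans hlm.symm)

theorem restrict_r_base_iff_of_color_eq {k l : ℕ} (hk : k < C.size) (hl : l < C.size)
    (h : C.color k = C.color l) :
    (restrict θ).r (base _ k) (base _ (k + 1)) ↔ (restrict θ).r (base _ l) (base _ (l + 1)) :=
  (restrict_r_side_iff_of_color_eq θ hk hk rfl).symm.trans
    (restrict_r_side_iff_of_color_eq θ hk hl h)

/-- The colours of the lines that are collapsed by a congruence. -/
def colors : LowerSet P where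
  carrier := {p | ∃ k < C.size, C.color k = p ∧ (restrict θ).r (base _ k) (base _ (k + 1))}
  lower' := by
    rintro q p hpq ⟨k, hk, rfl, hr⟩
    obtain ⟨f, hf, hq, rfl⟩ := C.exists_fork hpq
    have hlt := C.lt_size hf
    exact ⟨f + 1, hlt, rfl, r_base_succ_of_mem_forks _ hf
      ((restrict_r_base_iff_of_color_eq θ hk (Nat.lt_of_succ_lt hlt) hq.symm).1 hr)⟩

theorem color_mem_colors_iff {k : ℕ} (hk : k < C.size) :
    C.color k ∈ colors θ ↔ (restrict θ).r (base _ k) (base _ (k + 1)) := by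
  constructor
  · rintro ⟨l, hl, hc, hr⟩
    exact (restrict_r_base_iff_of_color_eq θ hl hk hc).1 hr
  · exact fun hr => ⟨k, hk, rfl, hr⟩

theorem gridCon_colors : C.gridCon (colors θ) = restrict θ := by
  have key (g h : C.Grid) : (C.gridCon (colors θ)).r g h ↔ (restrict θ).r g h := by
    rw [r_iff_base_side (restrict θ), latticeCon_r_iff_of_monotone (restrict θ) base_mono,
      latticeCon_r_iff_of_monotone (restrict θ) side_mono, ← forall_and]
    refine forall_congr' fun k => ?_
    rcases lt_or_ge k C.size with hk | hk
    · rw [restrict_r_side_iff_of_color_eq θ hk hk rfl, ← color_mem_colors_iff θ hk, ← imp_and]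
      rfl
    · have hx := iff_of_true (g.x_le.trans hk) (h.x_le.trans hk)
      have hy := iff_of_true (g.y_le.trans hk) (h.y_le.trans hk)
      exact iff_of_true (fun _ => ⟨hx, hy⟩) ⟨fun _ => hx, fun _ => hy⟩
  exact le_antisymm (fun g h => (key g h).1) (fun g h => (key g h).2)

theorem con_colors : C.con (colors θ) = θ := by
  have key (u v : C.Lat) : (C.con (colors θ)).r u v ↔ θ.r u v := by
    rw [r_iff_extendRel_restrict (θ := θ) fun e => ⟨_, _, isDiamond_eyes e⟩, ← gridCon_colors θ]
    rfl
  exact le_antisymm (fun u v => (key u v).1) (fun u v => (key u v).2)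

variable (C) in
/-- The congruences correspond to the lower sets of colours. -/
noncomputable def lowerSetIso : LowerSet P ≃o LatticeCon C.Lat :=
  RelIso.ofSurjective (OrderEmbedding.ofMapLEIff C.con fun _ _ => con_le_con_iff)
    fun θ => ⟨colors θ, con_colors θ⟩

end GridColoring

/-! ### Colourings by finite preordered sets -/

theorem exists_nat_enumeration (α : Type*) [Finite α] [Nonempty α] :
    ∃ (n : ℕ) (f : ℕ → α), ∀ a, ∃ k < n, f k = a := by
  obtain ⟨n, ⟨e⟩⟩ := Finite.exists_equiv_fin α
  let f : Fin n → α := e.symm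
  refine ⟨n, Function.extend Fin.val f fun _ => Classical.arbitrary α, fun a => ?_⟩
  exact ⟨e a, (e a).2, by rw [Fin.val_injective.extend_apply]; exact e.symm_apply_apply a⟩

section ColorSequence

variable {P : Type*}

/-- The sequence `c 0, …, c (n - 1), q₀, p₀, q₁, p₁, …` of colours, where `d k = (pₖ, qₖ)`. -/
def colorSequence (n : ℕ) (c : ℕ → P) (d : ℕ → P × P) (k : ℕ) : P :=
  if k < n then c k else if Even (k - n) then (d ((k - n) / 2)).2 else (d ((k - n) / 2)).1

variable {n : ℕ} {c : ℕ → P} {d : ℕ → P × P}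

theorem colorSequence_of_lt {k : ℕ} (hk : k < n) : colorSequence n c d k = c k := if_pos hk

theorem colorSequence_add_two_mul (k : ℕ) : colorSequence n c d (n + 2 * k) = (d k).2 := by
  simp [colorSequence]

theorem colorSequence_add_two_mul_succ (k : ℕ) : colorSequence n c d (n + 2 * k + 1) = (d k).1 := by
  have : n + 2 * k + 1 - n = 2 * k + 1 := by lia
  have hk : (2 * k + 1) / 2 = k := by lia
  simp [colorSequence, this, hk, show ¬n + 2 * k + 1 < n by lia]

end ColorSequence

theorem GridColoring.nonempty_of_finite (P : Type*) [Preorder P] [Finite P] [Nonempty P] :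
    Nonempty (GridColoring P) := by
  obtain ⟨n, c, hc⟩ := exists_nat_enumeration P
  have : Nonempty {q : P × P // q.1 ≤ q.2} :=
    ⟨⟨(Classical.arbitrary P, Classical.arbitrary P), le_rfl⟩⟩
  obtain ⟨m, d, hd⟩ := exists_nat_enumeration {q : P × P // q.1 ≤ q.2}
  exact ⟨{
    size := n + 2 * m
    forks := {f | ∃ k < m, f = n + 2 * k + 1}
    color := colorSequence n c fun k => d k
    free := n
    lt_size := by grind
    succ_notMem := by grind
    zero_notMem := by grind
    free_le_size := by lia
    free_lt := by grind
    exists_color p := by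
      obtain ⟨k, hk, rfl⟩ := hc p
      exact ⟨k, hk, colorSequence_of_lt hk⟩
    color_succ_le := by
      rintro _ ⟨k, -, h⟩
      obtain rfl := Nat.succ.inj h
      rw [colorSequence_add_two_mul, colorSequence_add_two_mul_succ]
      exact (d k).2
    exists_fork {p q} hpq := by
      obtain ⟨k, hk, hdk⟩ := hd ⟨(p, q), hpq⟩
      refine ⟨n + 2 * k, ⟨k, hk, rfl⟩, ?_, ?_⟩
      · rw [colorSequence_add_two_mul, hdk]
      · rw [colorSequence_add_two_mul_succ, hdk] }⟩

theorem exists_supIrred (α : Type*) [SemilatticeSup α] [OrderBot α] [WellFoundedLT α]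
    [Nontrivial α] : ∃ a : α, SupIrred a := by
  obtain ⟨a, ha⟩ := exists_ne (⊥ : α)
  obtain ⟨s, hs, hirred⟩ := exists_supIrred_decomposition a
  obtain ⟨b, hb⟩ : s.Nonempty := by
    rw [Finset.nonempty_iff_ne_empty]
    rintro rfl
    exact ha hs.symm
  exact ⟨b, hirred hb⟩

theorem theorem2 {D : Type*} [DistribLattice D] [Finite D] [Nontrivial D] :
    ∃ (K : Type) (_ : Lattice K) (_ : BoundedOrder K),
      IsRectangularLattice K ∧ Nonempty (D ≃o LatticeCon K) := by
  have := Fintype.ofFinite D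
  classical
  let := Fintype.toBoundedOrder D
  have : Nonempty {a : D // SupIrred a} := nonempty_subtype.2 (exists_supIrred D)
  obtain ⟨C⟩ := GridColoring.nonempty_of_finite {a : D // SupIrred a}
  exact ⟨C.Lat, inferInstance, inferInstance, C.isRectangularLattice,
    ⟨OrderIso.lowerSetSupIrred.trans C.lowerSetIso⟩⟩
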